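/- Let $k$ be a field and $h\ge 2$ an integer. Put $m_0=2h(2h-1)$, $m_1=(2h+1)(2h-1)$, $m_2=2h(2h+1)$, $m_3=2h(2h+1)+(2h-1)$, let $\Gamma_h=\langle m_0,m_1,m_2,m_3\rangle\subseteq\mathbb{N}$ be the Bresinsky semigroup, let $R=k[[t^{m_0},t^{m_1},t^{m_2},t^{m_3}]]\subseteq k[[t]]$ with maximal ideal $\mathfrak m$, and let $I=(t^{m_0})\subseteq R$. Let $G_{\mathfrak m}(\Gamma_h)=\bigoplus_{n\ge 0}\mathfrak m^n/\mathfrak m^{n+1}$ be the tangent cone and $F(I)=\bigoplus_{n\ge 0}I^n/\mathfrak m I^n$ the fiber cone of $I$; regard $G_{\mathfrak m}(\Gamma_h)$ as a graded $F(I)$-module through the natural maps $I^n/\mathfrak m I^n\to\mathfrak m^n/\mathfrak m^{n+1}$. For a graded module $M$ let $M(a)$ be the twist with $M(a)_n=M_{a+n}$. Then $G_{\mathfrak m}(\Gamma_h)$ is a free $F(I)$-module; moreover there is an isomorphism of graded $F(I)$-modules $$G_{\mathfrak m}(\Gamma_h)\;\cong\;\bigoplus_{j=0}^{2h-2}\bigl(F(I)(-j)\bigr)^{2j+1}\;\oplus\;\bigl(F(I)(-(2h-1))\bigr)^{2h-1}.$$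 -/

import Mathlib

noncomputable section

namespace MonomialCurve

section SemigroupRing

variable (k : Type*) [Field k] (Γ : AddSubmonoid ℕ)

/-- The ring `k[[Γ]] = k[[t^s : s ∈ Γ]]`, the subalgebra of `k[[t]]` of all formal power series
whose exponents lie in `Γ`. If `Γ` is generated by `a₁, …, aₑ`, this is
`k[[t^{a₁}, …, t^{aₑ}]]`. -/
def semigroupRing : Subalgebra k (PowerSeries k) where
  carrier := {f | ∀ n, n ∉ Γ → PowerSeries.coeff n f = 0}
  mul_mem' {f g} hf hg n hn := by
    rw [PowerSeries.coeff_mul]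
    refine Finset.sum_eq_zero fun p hp => ?_
    have hp := Finset.HasAntidiagonal.mem_antidiagonal.mp hp
    by_cases h1 : p.1 ∈ Γ
    · by_cases h2 : p.2 ∈ Γ
      · exact absurd (hp ▸ Γ.add_mem h1 h2) hn
      · rw [hg _ h2, mul_zero]
    · rw [hf _ h1, zero_mul]
  add_mem' {f g} hf hg n hn := by
    rw [map_add, hf n hn, hg n hn, add_zero]
  algebraMap_mem' r n hn := by
    have h0 : n ≠ 0 := fun h => hn (h ▸ Γ.zero_mem)
    simp [PowerSeries.coeff_C, h0]

variable {Γ} in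
/-- The element `t^s` of `k[[Γ]]`, for `s ∈ Γ`. -/
def tPow (s : ℕ) (hs : s ∈ Γ) : semigroupRing k Γ :=
  ⟨PowerSeries.X ^ s, fun n hn => by
    rw [PowerSeries.coeff_X_pow, if_neg (by rintro rfl; exact hn hs)]⟩

variable {k Γ}

theorem inv_mem_semigroupRing {f : PowerSeries k} (hf : f ∈ semigroupRing k Γ) :
    f⁻¹ ∈ semigroupRing k Γ := by
  intro n
  induction n using Nat.strong_induction_on with
  | _ n ih =>
    intro hn
    have h0 : n ≠ 0 := fun h => hn (h ▸ Γ.zero_mem)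
    rw [PowerSeries.coeff_inv, if_neg h0]
    refine mul_eq_zero_of_right _ (Finset.sum_eq_zero fun p hp => ?_)
    have hp := Finset.HasAntidiagonal.mem_antidiagonal.mp hp
    split_ifs with hlt
    · by_cases h1 : p.1 ∈ Γ
      · by_cases h2 : p.2 ∈ Γ
        · exact absurd (hp ▸ Γ.add_mem h1 h2) hn
        · rw [ih _ hlt h2, mul_zero]
      · rw [hf _ h1, zero_mul]
    · rfl

theorem isUnit_iff (f : semigroupRing k Γ) :
    IsUnit f ↔ PowerSeries.constantCoeff (f : PowerSeries k) ≠ 0 := by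
  constructor
  · intro h
    exact ((h.map (semigroupRing k Γ).val).map (PowerSeries.constantCoeff (R := k))).ne_zero
  · intro h
    refine IsUnit.of_mul_eq_one ⟨_, inv_mem_semigroupRing f.2⟩ ?_
    exact Subtype.ext (PowerSeries.mul_inv_cancel _ h)

instance : IsLocalRing (semigroupRing k Γ) :=
  IsLocalRing.of_nonunits_add fun a b ha hb => by
    rw [mem_nonunits_iff, isUnit_iff, not_not] at *
    rw [Subalgebra.coe_add, map_add, ha, hb, add_zero]

theorem tPow_mem_maximalIdeal (s : ℕ) (hs : s ∈ Γ) (h0 : s ≠ 0) :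
    tPow k s hs ∈ IsLocalRing.maximalIdeal (semigroupRing k Γ) := by
  rw [IsLocalRing.mem_maximalIdeal, mem_nonunits_iff, isUnit_iff, not_not]
  simp [tPow, h0]

end SemigroupRing

section Graded

universe u

variable {R : Type u} [CommRing R]

/-- The graded `R`-algebra `⨁ₙ Iⁿ / J Iⁿ`, as the quotient of the Rees algebra
`R[It] = ⨁ₙ Iⁿ tⁿ` by its ideal generated by `J`. -/
def ReesQuotient {R : Type u} [CommRing R] (I J : Ideal R) : Type u :=
  reesAlgebra I ⧸ J.map (algebraMap R (reesAlgebra I))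

instance (I J : Ideal R) : CommRing (ReesQuotient I J) :=
  inferInstanceAs (CommRing (reesAlgebra I ⧸ J.map (algebraMap R (reesAlgebra I))))

instance (I J : Ideal R) : Algebra R (ReesQuotient I J) :=
  inferInstanceAs (Algebra R (reesAlgebra I ⧸ J.map (algebraMap R (reesAlgebra I))))

/-- The quotient map from the Rees algebra of `I` to `⨁ₙ Iⁿ / J Iⁿ`. -/
def ReesQuotient.mk (I J : Ideal R) : reesAlgebra I →ₐ[R] ReesQuotient I J :=
  Ideal.Quotient.mkₐ R (J.map (algebraMap R (reesAlgebra I)))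

/-- The homogeneous component of degree `n : ℤ` of `⨁ₙ Iⁿ / J Iⁿ`: the classes of the elements
`a tⁿ` of the Rees algebra. It is zero for negative `n`. -/
def ReesQuotient.component (I J : Ideal R) (n : ℤ) : Submodule R (ReesQuotient I J) where
  carrier := {x | ∃ f : reesAlgebra I,
    (∀ i : ℕ, (i : ℤ) ≠ n → (f : Polynomial R).coeff i = 0) ∧ ReesQuotient.mk I J f = x}
  zero_mem' := ⟨0, by simp, map_zero _⟩
  add_mem' := by
    rintro _ _ ⟨f, hf, rfl⟩ ⟨g, hg, rfl⟩
    exact ⟨f + g, fun i hi => by simp [hf i hi, hg i hi], map_add _ _ _⟩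
  smul_mem' := by
    rintro r _ ⟨f, hf, rfl⟩
    exact ⟨r • f, fun i hi => by simp [hf i hi], map_smul _ _ _⟩

/-- The twist `M(a)` of a `ℤ`-grading: `M(a)ₙ = M_{a+n}`. -/
def twist {M : Type*} [AddCommGroup M] [Module R M] (𝓜 : ℤ → Submodule R M) (a : ℤ) :
    ℤ → Submodule R M :=
  fun n => 𝓜 (a + n)

theorem reesAlgebra_mono {I I' : Ideal R} (h : I ≤ I') : reesAlgebra I ≤ reesAlgebra I' :=
  fun _ hf i => Ideal.pow_right_mono h i (hf i)

/-- For `I ≤ I'`, the natural homomorphism of graded rings `⨁ₙ Iⁿ / J Iⁿ → ⨁ₙ I'ⁿ / J I'ⁿ`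
induced by the inclusions `Iⁿ ⊆ I'ⁿ`. -/
def ReesQuotient.map {I I' : Ideal R} (J : Ideal R) (h : I ≤ I') :
    ReesQuotient I J →+* ReesQuotient I' J :=
  Ideal.quotientMap _ (Subalgebra.inclusion (reesAlgebra_mono h)).toRingHom <| by
    rw [Ideal.map_le_iff_le_comap]
    intro r hr
    rw [Ideal.mem_comap, Ideal.mem_comap]
    exact Ideal.mem_map_of_mem (algebraMap R (reesAlgebra I')) hr

variable [IsLocalRing R]

/-- The fiber cone `F(I) = ⨁ₙ Iⁿ / 𝔪 Iⁿ` of an ideal of a local ring `(R, 𝔪)`. -/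
abbrev FiberCone (I : Ideal R) : Type u := ReesQuotient I (IsLocalRing.maximalIdeal R)

/-- The degree `n` component `F(I)ₙ = Iⁿ / 𝔪 Iⁿ` of the fiber cone. -/
abbrev fiberConeComponent (I : Ideal R) (n : ℤ) : Submodule R (FiberCone I) :=
  ReesQuotient.component I (IsLocalRing.maximalIdeal R) n

variable (R) in
/-- The tangent cone `G_𝔪 = ⨁ₙ 𝔪ⁿ / 𝔪ⁿ⁺¹` of a local ring `(R, 𝔪)`. -/
abbrev TangentCone : Type u :=
  ReesQuotient (IsLocalRing.maximalIdeal R) (IsLocalRing.maximalIdeal R)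

variable (R) in
/-- The degree `n` component `𝔪ⁿ / 𝔪ⁿ⁺¹` of the tangent cone. -/
abbrev tangentConeComponent (n : ℤ) : Submodule R (TangentCone R) :=
  ReesQuotient.component (IsLocalRing.maximalIdeal R) (IsLocalRing.maximalIdeal R) n

/-- The natural `F(I)`-module structure on the tangent cone, for `I ⊆ 𝔪`, given by the ring
homomorphism `F(I) → G_𝔪` with components `Iⁿ / 𝔪 Iⁿ → 𝔪ⁿ / 𝔪ⁿ⁺¹`. -/
abbrev tangentConeModule {I : Ideal R} (hI : I ≤ IsLocalRing.maximalIdeal R) :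
    Module (FiberCone I) (TangentCone R) :=
  Module.compHom (TangentCone R) (ReesQuotient.map (IsLocalRing.maximalIdeal R) hI)

end Graded

section Bresinsky

/-- The Bresinsky semigroup `Γ_h`, generated by `m₀ = 2h(2h-1)`, `m₁ = (2h+1)(2h-1)`,
`m₂ = 2h(2h+1)` and `m₃ = 2h(2h+1)+(2h-1)`. -/
def bresinsky (h : ℕ) : AddSubmonoid ℕ :=
  AddSubmonoid.closure {2 * h * (2 * h - 1), (2 * h + 1) * (2 * h - 1), 2 * h * (2 * h + 1),
    2 * h * (2 * h + 1) + (2 * h - 1)}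

theorem m0_mem_bresinsky (h : ℕ) : 2 * h * (2 * h - 1) ∈ bresinsky h :=
  AddSubmonoid.subset_closure (by simp)

/-- The local ring `k[[t^{m₀}, t^{m₁}, t^{m₂}, t^{m₃}]]` of the Bresinsky curve. -/
abbrev BresinskyRing (k : Type*) [Field k] (h : ℕ) : Type _ := semigroupRing k (bresinsky h)

/-- The ideal `I = (t^{m₀})`. -/
def bresinskyIdeal (k : Type*) [Field k] (h : ℕ) : Ideal (BresinskyRing k h) :=
  Ideal.span {tPow k (2 * h * (2 * h - 1)) (m0_mem_bresinsky h)}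

theorem bresinskyIdeal_le (k : Type*) [Field k] {h : ℕ} (hh : 2 ≤ h) :
    bresinskyIdeal k h ≤ IsLocalRing.maximalIdeal (BresinskyRing k h) := by
  rw [bresinskyIdeal, Ideal.span_singleton_le_iff_mem]
  exact tPow_mem_maximalIdeal _ _ (Nat.mul_ne_zero (by omega) (by omega))

end Bresinsky

end MonomialCurve

end

/-! Put `b = 2h - 1` and `m = m₀ = (b + 1)b`. The generators are `m + e·b + 2f(b + 1)` with `e, f ∈
{0, 1}`, so sums of `d` of them are exactly the `d·m + E·b + 2D(b + 1)` with `E, D ≤ d`. Reducing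
`E` mod `b + 1` carries one `m`, reducing `D` mod `b` carries two; carries only raise `d`. As `b` is
odd, the reduced form is unique (`eq_and_eq_of_mul_add_eq`), so the Apéry set corresponds to pairs
`E ≤ b`, `D < b`, with order `max E D`; counting pairs by maximum gives the ranks.

The order `o i + n` of `w i + n * m` is superadditive (`le_of_mul_add_eq`), so `𝔪^d` consists of the
series whose exponents have order at least `d` (`maximalIdeal_pow_coeff`, `mem_maximalIdeal_pow`).
Hence `𝔪^d / 𝔪^{d+1}` has as basis the monomials of order `d`, while `F(I)` has one basis element
`t^{nm}` in each degree `n`. The classes of `t^{w i}` in degree `o i` are then a homogeneous basis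
of the tangent cone over `F(I)`. -/

noncomputable section

namespace MonomialCurve

open IsLocalRing

/-! ### Vanishing and homogeneity in quotients of Rees algebras -/

namespace ReesQuotient

variable {R : Type*} [CommRing R] (I J : Ideal R)

theorem mk_surjective : Function.Surjective (ReesQuotient.mk I J) :=
  Ideal.Quotient.mkₐ_surjective R _

variable {I J}

theorem mem_map_algebraMap_iff (f : reesAlgebra I) :
    f ∈ J.map (algebraMap R (reesAlgebra I)) ↔
      ∀ n, (f : Polynomial R).coeff n ∈ J * I ^ n := by
  constructor
  · intro hf
    refine Submodule.span_induction ?_ ?_ ?_ ?_ hf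
    · rintro _ ⟨r, hr, rfl⟩ n
      change (Polynomial.C r).coeff n ∈ _
      rw [Polynomial.coeff_C]
      split_ifs with h
      · subst h
        simpa using hr
      · exact zero_mem _
    · intro n
      simp
    · intro x y _ _ hx hy n
      simpa using add_mem (hx n) (hy n)
    · intro g x _ hx n
      rw [smul_eq_mul, Subalgebra.coe_mul, Polynomial.coeff_mul]
      refine sum_mem fun p hp => ?_
      rw [← Finset.HasAntidiagonal.mem_antidiagonal.mp hp, pow_add, mul_left_comm]
      exact Ideal.mul_mem_mul (g.2 p.1) (hx p.2)
  · intro hf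
    have hmon : ∀ n, ∀ r ∈ J * I ^ n, ∃ hr : Polynomial.monomial n r ∈ reesAlgebra I,
        (⟨Polynomial.monomial n r, hr⟩ : reesAlgebra I) ∈
          J.map (algebraMap R (reesAlgebra I)) := by
      intro n r h
      refine Submodule.mul_induction_on h ?_ ?_
      · intro x hx y hy
        have hy' : Polynomial.monomial n y ∈ reesAlgebra I :=
          reesAlgebra.monomial_mem.mpr hy
        refine ⟨reesAlgebra.monomial_mem.mpr (Ideal.mul_mem_left _ _ hy), ?_⟩
        convert Ideal.mul_mem_left _ (⟨Polynomial.monomial n y, hy'⟩ : reesAlgebra I) (Ideal.mem_map_of_mem _ hx)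
          using 1
        refine Subtype.ext ?_
        change Polynomial.monomial n (x * y) = Polynomial.monomial n y * Polynomial.C x
        rw [Polynomial.monomial_mul_C, mul_comm]
      · rintro x y ⟨hx, hx'⟩ ⟨hy, hy'⟩
        refine ⟨by rw [map_add]; exact add_mem hx hy, ?_⟩
        convert add_mem hx' hy' using 1
        exact Subtype.ext (map_add _ _ _)
    choose hr hmem using fun n => hmon n _ (hf n)
    have : f = ∑ n ∈ (f : Polynomial R).support, ⟨_, hr n⟩ := by
      refine Subtype.ext ?_
      rw [AddSubmonoidClass.coe_finsetSum]
      exact (f : Polynomial R).as_sum_support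
    rw [this]
    exact sum_mem fun n _ => hmem n

theorem mk_eq_zero_iff (f : reesAlgebra I) :
    ReesQuotient.mk I J f = 0 ↔ ∀ n, (f : Polynomial R).coeff n ∈ J * I ^ n :=
  Ideal.Quotient.eq_zero_iff_mem.trans (mem_map_algebraMap_iff f)

theorem mk_mem_component_iff (f : reesAlgebra I) (n : ℤ) :
    ReesQuotient.mk I J f ∈ component I J n ↔
      ∀ i : ℕ, (i : ℤ) ≠ n → (f : Polynomial R).coeff i ∈ J * I ^ i := by
  constructor
  · rintro ⟨g, hg, hgf⟩ i hi
    have h : ReesQuotient.mk I J (f - g) = 0 := by rw [map_sub, hgf, sub_self]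
    simpa [hg i hi] using (mk_eq_zero_iff _).mp h i
  · intro hf
    -- For negative `n`, `n.toNat` is `0`; the test then makes the representative zero instead of a
    -- degree `0` term.
    refine ⟨⟨Polynomial.monomial n.toNat (if (n.toNat : ℤ) = n then
      (f : Polynomial R).coeff n.toNat else 0), ?_⟩, ?_, ?_⟩
    · rw [reesAlgebra.monomial_mem]
      split_ifs
      · exact f.2 _
      · exact zero_mem _
    · intro i hi
      change (Polynomial.monomial _ _).coeff i = 0
      rw [Polynomial.coeff_monomial]
      split_ifs with h1 h2
      · exact absurd (h1 ▸ h2) hi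
      · rfl
      · rfl
    · rw [eq_comm, ← sub_eq_zero, ← map_sub, mk_eq_zero_iff]
      intro i
      rw [AddSubgroupClass.coe_sub, Polynomial.coeff_sub, Polynomial.coeff_monomial]
      by_cases hi : (i : ℤ) = n
      · subst hi
        simp
      · rw [show (if n.toNat = i then (if (n.toNat : ℤ) = n then
          (f : Polynomial R).coeff n.toNat else 0) else 0) = 0 by
            split_ifs with h1 h2
            · exact absurd (h1 ▸ h2) hi
            · rfl
            · rfl, sub_zero]
        exact hf i hi

end ReesQuotient

/-! ### Apéry orders and ideal powers read off coefficients -/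

/-- `w` lists the Apéry set of `Γ` with respect to `m`, and `o` is a function on it for which
`w i + n * m ↦ o i + n` is superadditive on `Γ`. -/
structure IsAperyOrder (Γ : AddSubmonoid ℕ) (m : ℕ) {ι : Type*} (w o : ι → ℕ) : Prop where
  mem : m ∈ Γ
  ne_zero : m ≠ 0
  apery_mem : ∀ i, w i ∈ Γ
  exists_eq : ∀ s ∈ Γ, ∃ i n, s = w i + n * m
  index_eq : ∀ i j n n', w i + n * m = w j + n' * m → i = j
  superadd : ∀ i j l n n', w i + w j + n * m = w l + n' * m → o i + o j + n ≤ o l + n'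
  eq_zero : ∀ i, o i = 0 → w i = 0

section SemigroupRing

variable {k : Type*} [Field k] {Γ : AddSubmonoid ℕ}

/-- The coefficient of `t^s`, as a linear form on `k[[Γ]]`. -/
def semigroupRing.coeff (s : ℕ) : semigroupRing k Γ →ₗ[k] k :=
  (PowerSeries.coeff s).comp (semigroupRing k Γ).val.toLinearMap

namespace semigroupRing

theorem coeff_apply (s : ℕ) (f : semigroupRing k Γ) :
    coeff s f = PowerSeries.coeff s (f : PowerSeries k) := rfl

theorem mem_of_coeff_ne_zero {s : ℕ} {f : semigroupRing k Γ} (h : coeff s f ≠ 0) : s ∈ Γ := by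
  by_contra hs
  exact h (f.2 s hs)

theorem exists_coeff_ne_zero_of_mul {s : ℕ} {f g : semigroupRing k Γ}
    (h : coeff s (f * g) ≠ 0) : ∃ p q, p + q = s ∧ coeff p f ≠ 0 ∧ coeff q g ≠ 0 := by
  rw [coeff_apply, Subalgebra.coe_mul, PowerSeries.coeff_mul] at h
  obtain ⟨p, hp, hne⟩ := Finset.exists_ne_zero_of_sum_ne_zero h
  exact ⟨p.1, p.2, Finset.HasAntidiagonal.mem_antidiagonal.mp hp, left_ne_zero_of_mul hne,
    right_ne_zero_of_mul hne⟩

theorem mem_maximalIdeal_iff (f : semigroupRing k Γ) :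
    f ∈ maximalIdeal (semigroupRing k Γ) ↔ coeff 0 f = 0 := by
  rw [mem_maximalIdeal, mem_nonunits_iff, isUnit_iff, not_not, coeff_apply,
    PowerSeries.coeff_zero_eq_constantCoeff_apply]

theorem coeff_tPow_mul {s : ℕ} (hs : s ∈ Γ) (f : semigroupRing k Γ) (n : ℕ) :
    coeff n (tPow k s hs * f) = if s ≤ n then coeff (n - s) f else 0 :=
  PowerSeries.coeff_X_pow_mul' _ _ _

theorem tPow_mul_tPow {s t : ℕ} (hs : s ∈ Γ) (ht : t ∈ Γ) :
    tPow k s hs * tPow k t ht = tPow k (s + t) (Γ.add_mem hs ht) :=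
  Subtype.ext (pow_add _ _ _).symm

theorem tPow_pow {s : ℕ} (hs : s ∈ Γ) (n : ℕ) :
    tPow k s hs ^ n = tPow k (n * s) (by simpa using Γ.nsmul_mem hs n) :=
  Subtype.ext (by simp [tPow, ← pow_mul, mul_comm])

theorem mul_mem_of_mem {m : ℕ} (hm : m ∈ Γ) (n : ℕ) : n * m ∈ Γ := by
  simpa using Γ.nsmul_mem hm n

/-- Writing `f = u * t^(i * m)`, the condition is that `u` has no constant term. Thus a single
coefficient describes each component of the fiber cone. -/
theorem mem_maximalIdeal_mul_span_pow_iff {m : ℕ} (hm : m ∈ Γ) (i : ℕ) {f : semigroupRing k Γ}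
    (hf : f ∈ Ideal.span {tPow k m hm} ^ i) :
    f ∈ maximalIdeal (semigroupRing k Γ) * Ideal.span {tPow k m hm} ^ i ↔
      coeff (i * m) f = 0 := by
  rw [Ideal.span_singleton_pow] at *
  obtain ⟨u, rfl⟩ := Ideal.mem_span_singleton'.mp hf
  rw [Ideal.mem_mul_span_singleton, tPow_pow hm]
  have hu : ∀ v : semigroupRing k Γ, coeff (i * m) (v * tPow k (i * m) (mul_mem_of_mem hm i)) =
      coeff 0 v := by
    intro v
    rw [mul_comm v, coeff_tPow_mul, if_pos le_rfl, Nat.sub_self]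
  constructor
  · rintro ⟨z, hz, hzu⟩
    rw [← hzu, hu]
    exact (mem_maximalIdeal_iff z).mp hz
  · intro h
    rw [hu] at h
    exact ⟨u, (mem_maximalIdeal_iff u).mpr h, rfl⟩

variable {m : ℕ} {ι : Type*} {w o : ι → ℕ}

/-- Exponents of elements of `𝔪` have order at least `1`, since only exponent `0` has order `0`;
superadditivity propagates this to products. -/
theorem maximalIdeal_pow_coeff (hA : IsAperyOrder Γ m w o) {d : ℕ} {f : semigroupRing k Γ}
    (hf : f ∈ maximalIdeal (semigroupRing k Γ) ^ d) {l : ι} {n : ℕ} (hd : o l + n < d) :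
    coeff (w l + n * m) f = 0 := by
  induction d generalizing f l n with
  | zero => omega
  | succ d ih =>
    rw [pow_succ] at hf
    refine Submodule.mul_induction_on hf ?_ ?_
    · intro x hx y hy
      by_contra hne
      obtain ⟨p, q, hpq, hp, hq⟩ := exists_coeff_ne_zero_of_mul hne
      obtain ⟨i, a, rfl⟩ := hA.exists_eq p (mem_of_coeff_ne_zero hp)
      obtain ⟨j, b, rfl⟩ := hA.exists_eq q (mem_of_coeff_ne_zero hq)
      have h1 : d ≤ o i + a := by
        by_contra h
        exact hp (ih hx (by omega))
      have h2 : 1 ≤ o j + b := by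
        by_contra h
        have hb : b = 0 := by omega
        rw [hA.eq_zero j (by omega), hb, zero_mul] at hq
        exact hq ((mem_maximalIdeal_iff y).mp hy)
      have h3 := hA.superadd i j l (a + b) n (by rw [← hpq]; ring)
      omega
    · intro x y hx hy
      rw [map_add, hx, hy, add_zero]

/-- A series has infinitely many terms, so they are grouped by Apéry class: `f` is a finite sum of
multiples of monomials that lie in `𝔪^d`. -/
theorem mem_maximalIdeal_pow [Fintype ι] (hA : IsAperyOrder Γ m w o)
    (hpow : ∀ i, tPow k (w i) (hA.apery_mem i) ∈ maximalIdeal (semigroupRing k Γ) ^ o i)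
    {d : ℕ} {f : semigroupRing k Γ}
    (hf : ∀ l n, o l + n < d → coeff (w l + n * m) f = 0) :
    f ∈ maximalIdeal (semigroupRing k Γ) ^ d := by
  classical
  -- The least `n` with `o l + n ≥ d` is the truncated `d - o l`; `u l` is the class `l` part of `f`
  -- divided by `t^(w l + (d - o l) * m)`.
  let u : ι → semigroupRing k Γ := fun l =>
    ⟨PowerSeries.mk fun r => if m ∣ r then coeff (w l + (d - o l) * m + r) f else 0, by
      intro r hr
      rw [PowerSeries.coeff_mk, if_neg]
      rintro ⟨c, rfl⟩
      exact hr (mul_comm m c ▸ mul_mem_of_mem hA.mem c)⟩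
  have hmem : ∀ l, w l + (d - o l) * m ∈ Γ := fun l =>
    Γ.add_mem (hA.apery_mem l) (mul_mem_of_mem hA.mem _)
  have hu : ∀ l s, coeff s (tPow k _ (hmem l) * u l) =
      if ∃ n, d ≤ o l + n ∧ s = w l + n * m then coeff s f else 0 := by
    intro l s
    rw [coeff_tPow_mul]
    have hr : ∀ r, coeff r (u l) = if m ∣ r then coeff (w l + (d - o l) * m + r) f else 0 :=
      fun r => PowerSeries.coeff_mk r
        fun r => if m ∣ r then coeff (w l + (d - o l) * m + r) f else 0
    split_ifs with h1 h2 h2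
    · obtain ⟨n, hn, rfl⟩ := h2
      rw [hr, if_pos, Nat.add_sub_cancel' h1]
      rw [Nat.add_sub_add_left, ← Nat.sub_mul]
      exact dvd_mul_left _ _
    · rw [hr, if_neg]
      rintro ⟨c, hc⟩
      refine h2 ⟨d - o l + c, by omega, ?_⟩
      rw [add_mul, mul_comm c, ← hc]
      omega
    · obtain ⟨n, hn, rfl⟩ := h2
      refine absurd (Nat.add_le_add_left (Nat.mul_le_mul_right m ?_) _) h1
      omega
    · rfl
  have hsum : f = ∑ l, tPow k _ (hmem l) * u l := by
    refine Subtype.ext (PowerSeries.ext fun s => ?_)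
    change coeff s f = coeff s (∑ l, tPow k _ (hmem l) * u l)
    rw [map_sum]
    simp_rw [hu]
    by_cases h0 : coeff s f = 0
    · simp [h0]
    obtain ⟨j, n, rfl⟩ := hA.exists_eq s (mem_of_coeff_ne_zero h0)
    rw [Finset.sum_eq_single j]
    · rw [if_pos]
      refine ⟨n, ?_, rfl⟩
      by_contra h
      exact h0 (hf j n (by omega))
    · rintro l - hl
      rw [if_neg]
      rintro ⟨n', -, h⟩
      exact hl (hA.index_eq _ _ _ _ h).symm
    · simp
  rw [hsum]
  refine sum_mem fun l _ => Ideal.mul_mem_right _ _ ?_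
  have hx : tPow k m hA.mem ∈ maximalIdeal (semigroupRing k Γ) :=
    tPow_mem_maximalIdeal _ _ hA.ne_zero
  have := Ideal.mul_mem_mul (hpow l) (Ideal.pow_mem_pow hx (d - o l))
  rw [tPow_pow, tPow_mul_tPow, ← pow_add] at this
  exact Ideal.pow_le_pow_right (by omega) this

end semigroupRing

end SemigroupRing

/-! ### Freeness of the tangent cone over the fiber cone -/

section TangentCone

variable {k : Type*} [Field k] {Γ : AddSubmonoid ℕ} {m : ℕ} {ι : Type*} {w o : ι → ℕ}

open semigroupRing

theorem mem_maximalIdeal_mul_pow_iff [Fintype ι] (hA : IsAperyOrder Γ m w o)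
    (hpow : ∀ i, tPow k (w i) (hA.apery_mem i) ∈ maximalIdeal (semigroupRing k Γ) ^ o i)
    {d : ℕ} {f : semigroupRing k Γ} (hf : f ∈ maximalIdeal (semigroupRing k Γ) ^ d) :
    f ∈ maximalIdeal (semigroupRing k Γ) * maximalIdeal (semigroupRing k Γ) ^ d ↔
      ∀ l n, o l + n = d → coeff (w l + n * m) f = 0 := by
  rw [← pow_succ']
  constructor
  · intro h l n hd
    exact maximalIdeal_pow_coeff hA h (by omega)
  · intro h
    refine mem_maximalIdeal_pow hA hpow fun l n hd => ?_
    rcases Nat.lt_succ_iff_lt_or_eq.mp hd with h1 | h1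
    · exact maximalIdeal_pow_coeff hA hf h1
    · exact h l n h1

/-- Different Apéry classes do not interact in the associated graded: multiplying `t^(w i + j * m)`
by a nonconstant monomial strictly raises the order, so it contributes nothing at order `o i + j`.
-/
theorem coeff_mul_tPow_of_mem_span_pow [DecidableEq ι] (hA : IsAperyOrder Γ m w o)
    {i l : ι} {j n : ℕ} {f : semigroupRing k Γ} (hf : f ∈ Ideal.span {tPow k m hA.mem} ^ j)
    (hd : o i + j = o l + n) :
    coeff (w l + n * m) (f * tPow k (w i) (hA.apery_mem i)) =
      if i = l then coeff (n * m) f else 0 := by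
  split_ifs with hil
  · subst hil
    rw [mul_comm f, coeff_tPow_mul, if_pos (by omega), Nat.add_sub_cancel_left]
  · rw [Ideal.span_singleton_pow] at hf
    obtain ⟨u, rfl⟩ := Ideal.mem_span_singleton'.mp hf
    rw [mul_assoc, tPow_pow, tPow_mul_tPow, mul_comm u, coeff_tPow_mul]
    split_ifs with hle
    · by_contra hne
      obtain ⟨a, b, hab⟩ := hA.exists_eq _ (mem_of_coeff_ne_zero hne)
      have heq : w i + w a + (j + b) * m = w l + n * m := by
        rw [add_mul]
        omega
      have h1 := hA.superadd _ _ _ _ _ heq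
      -- With `hd`, superadditivity leaves `o a + b ≤ 0`, so the exponent taken from `u` is zero.
      have hb : b = 0 := by omega
      subst hb
      rw [hA.eq_zero a (by omega)] at heq
      exact hil (hA.index_eq i l (j + 0) n (by simpa using heq))
    · rfl

/-- The element `t^{w i} T^{o i}` of the Rees algebra of the maximal ideal. -/
def aperyRees {Γ : AddSubmonoid ℕ} {w o : ι → ℕ} (hw : ∀ i, w i ∈ Γ)
    (hpow : ∀ i, tPow k (w i) (hw i) ∈ maximalIdeal (semigroupRing k Γ) ^ o i) (i : ι) :
    reesAlgebra (maximalIdeal (semigroupRing k Γ)) :=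
  ⟨Polynomial.monomial (o i) (tPow k (w i) (hw i)), reesAlgebra.monomial_mem.mpr (hpow i)⟩

variable {I : Ideal (semigroupRing k Γ)}

/-- This recovers the coordinates of a combination of the basis candidates; injectivity,
surjectivity and the grading all follow from it. -/
theorem coeff_sum_mul_aperyRees [Fintype ι] (hA : IsAperyOrder Γ m w o)
    (hpow : ∀ i, tPow k (w i) (hA.apery_mem i) ∈ maximalIdeal (semigroupRing k Γ) ^ o i)
    (hIm : I = Ideal.span {tPow k m hA.mem}) (hI : I ≤ maximalIdeal (semigroupRing k Γ))
    (f : ι → reesAlgebra I) (l : ι) (n : ℕ) :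
    coeff (w l + n * m) (((∑ i, Subalgebra.inclusion (reesAlgebra_mono hI) (f i) *
        aperyRees hA.apery_mem hpow i : reesAlgebra (maximalIdeal (semigroupRing k Γ))) :
          Polynomial (semigroupRing k Γ)).coeff (o l + n)) =
      coeff (n * m) ((f l : Polynomial (semigroupRing k Γ)).coeff n) := by
  classical
  subst hIm
  rw [AddSubmonoidClass.coe_finsetSum, Polynomial.finsetSum_coeff, map_sum]
  have hterm : ∀ i, coeff (w l + n * m)
      (((Subalgebra.inclusion (reesAlgebra_mono hI) (f i) * aperyRees hA.apery_mem hpow i :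
        reesAlgebra (maximalIdeal (semigroupRing k Γ))) :
          Polynomial (semigroupRing k Γ)).coeff (o l + n)) =
      if i = l then coeff (n * m) ((f l : Polynomial (semigroupRing k Γ)).coeff n) else 0 := by
    intro i
    change coeff _ (((f i : Polynomial (semigroupRing k Γ)) *
      Polynomial.monomial (o i) (tPow k (w i) (hA.apery_mem i))).coeff (o l + n)) = _
    by_cases hle : o i ≤ o l + n
    · have h1 : o l + n = (o l + n - o i) + o i := by omega
      rw [h1, Polynomial.coeff_mul_monomial]
      rw [coeff_mul_tPow_of_mem_span_pow hA ((f i).2 _) (by omega)]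
      split_ifs with hil
      · subst hil
        rw [Nat.add_sub_cancel_left]
      · rfl
    · rw [← Polynomial.C_mul_X_pow_eq_monomial, ← mul_assoc, Polynomial.coeff_mul_X_pow',
        if_neg hle, map_zero, if_neg]
      rintro rfl
      omega
  simp_rw [hterm]
  simp

theorem fiberCone_mk_eq_zero_iff (hm : m ∈ Γ) (hIm : I = Ideal.span {tPow k m hm})
    (f : reesAlgebra I) :
    ReesQuotient.mk I (maximalIdeal (semigroupRing k Γ)) f = 0 ↔
      ∀ n, coeff (n * m) ((f : Polynomial (semigroupRing k Γ)).coeff n) = 0 := by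
  subst hIm
  rw [ReesQuotient.mk_eq_zero_iff]
  exact forall_congr' fun n => mem_maximalIdeal_mul_span_pow_iff hm n (f.2 n)

theorem fiberCone_mk_mem_component_iff (hm : m ∈ Γ) (hIm : I = Ideal.span {tPow k m hm})
    (f : reesAlgebra I) (d : ℤ) :
    ReesQuotient.mk I (maximalIdeal (semigroupRing k Γ)) f ∈ fiberConeComponent I d ↔
      ∀ n : ℕ, (n : ℤ) ≠ d → coeff (n * m) ((f : Polynomial (semigroupRing k Γ)).coeff n) = 0 := by
  subst hIm
  rw [ReesQuotient.mk_mem_component_iff]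
  exact forall_congr' fun n => imp_congr_right fun _ =>
    mem_maximalIdeal_mul_span_pow_iff hm n (f.2 n)

theorem tangentCone_mk_eq_zero_iff [Fintype ι] (hA : IsAperyOrder Γ m w o)
    (hpow : ∀ i, tPow k (w i) (hA.apery_mem i) ∈ maximalIdeal (semigroupRing k Γ) ^ o i)
    (g : reesAlgebra (maximalIdeal (semigroupRing k Γ))) :
    ReesQuotient.mk _ (maximalIdeal (semigroupRing k Γ)) g = 0 ↔
      ∀ l n, coeff (w l + n * m)
        ((g : Polynomial (semigroupRing k Γ)).coeff (o l + n)) = 0 := by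
  rw [ReesQuotient.mk_eq_zero_iff]
  refine (forall_congr' fun d => mem_maximalIdeal_mul_pow_iff hA hpow (g.2 d)).trans ?_
  exact ⟨fun h l n => h _ l n rfl, by rintro h _ l n rfl; exact h l n⟩

theorem tangentCone_mk_mem_component_iff [Fintype ι] (hA : IsAperyOrder Γ m w o)
    (hpow : ∀ i, tPow k (w i) (hA.apery_mem i) ∈ maximalIdeal (semigroupRing k Γ) ^ o i)
    (g : reesAlgebra (maximalIdeal (semigroupRing k Γ))) (d : ℤ) :
    ReesQuotient.mk _ (maximalIdeal (semigroupRing k Γ)) g ∈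
        tangentConeComponent (semigroupRing k Γ) d ↔
      ∀ l n, ((o l + n : ℕ) : ℤ) ≠ d → coeff (w l + n * m)
        ((g : Polynomial (semigroupRing k Γ)).coeff (o l + n)) = 0 := by
  rw [ReesQuotient.mk_mem_component_iff]
  refine (forall_congr' fun d => imp_congr_right fun _ =>
    mem_maximalIdeal_mul_pow_iff hA hpow (g.2 d)).trans ?_
  exact ⟨fun h l n hd => h _ hd l n rfl, by rintro h _ hd l n rfl; exact h l n hd⟩

/-- Elements of the Rees algebra are polynomials, so only finitely supported coordinates can be
prescribed; the element is `∑ a n • t^(n * m) Tⁿ`. -/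
theorem exists_reesAlgebra_coeff_eq (hm : m ∈ Γ) (hIm : I = Ideal.span {tPow k m hm})
    (a : ℕ → k) (N : ℕ) (ha : ∀ n, N ≤ n → a n = 0) :
    ∃ f : reesAlgebra I,
      ∀ n, coeff (n * m) ((f : Polynomial (semigroupRing k Γ)).coeff n) = a n := by
  classical
  have hmem : ∀ n, Polynomial.monomial n (a n • tPow k m hm ^ n) ∈ reesAlgebra I := by
    intro n
    rw [reesAlgebra.monomial_mem, hIm, Algebra.smul_def]
    exact Ideal.mul_mem_left _ _ (Ideal.pow_mem_pow (Ideal.mem_span_singleton_self _) n)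
  refine ⟨∑ n ∈ Finset.range N, ⟨_, hmem n⟩, fun n => ?_⟩
  rw [AddSubmonoidClass.coe_finsetSum, Polynomial.finsetSum_coeff]
  simp only [Polynomial.coeff_monomial]
  rw [Finset.sum_ite_eq']
  split_ifs with hn
  · have h1 := coeff_tPow_mul (k := k) (mul_mem_of_mem hm n) 1 (n * m)
    rw [if_pos le_rfl, mul_one, Nat.sub_self] at h1
    rw [map_smul, tPow_pow, h1]
    simp [coeff_apply]
  · rw [map_zero, ha n (by simpa using hn)]

/-- The tangent cone of `k[[Γ]]` is free over the fiber cone of `(t^m)`, on generators of degree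
`o i` indexed by the Apéry set. -/
theorem exists_graded_linearEquiv_tangentCone [Fintype ι] (hA : IsAperyOrder Γ m w o)
    (hpow : ∀ i, tPow k (w i) (hA.apery_mem i) ∈ maximalIdeal (semigroupRing k Γ) ^ o i)
    (hIm : I = Ideal.span {tPow k m hA.mem}) (hI : I ≤ maximalIdeal (semigroupRing k Γ)) :
    letI : Module (FiberCone I) (TangentCone (semigroupRing k Γ)) := tangentConeModule hI
    ∃ φ : (ι → FiberCone I) ≃ₗ[FiberCone I] TangentCone (semigroupRing k Γ),
      ∀ (n : ℤ) x, φ x ∈ tangentConeComponent (semigroupRing k Γ) n ↔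
        ∀ i, x i ∈ twist (fiberConeComponent I) (-(o i : ℤ)) n := by
  let : Module (FiberCone I) (TangentCone (semigroupRing k Γ)) := tangentConeModule hI
  let L : (ι → FiberCone I) →ₗ[FiberCone I] TangentCone (semigroupRing k Γ) :=
    Fintype.linearCombination (FiberCone I)
      fun i => ReesQuotient.mk _ _ (aperyRees hA.apery_mem hpow i)
  have hL : ∀ f : ι → reesAlgebra I, L (fun i => ReesQuotient.mk I _ (f i)) =
      ReesQuotient.mk _ _ (∑ i, Subalgebra.inclusion (reesAlgebra_mono hI) (f i) *
        aperyRees hA.apery_mem hpow i) := by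
    intro f
    rw [map_sum]
    refine Finset.sum_congr rfl fun i _ => ?_
    rw [map_mul]
    rfl
  have hrep : ∀ x : ι → FiberCone I, ∃ f : ι → reesAlgebra I,
      x = fun i => ReesQuotient.mk I _ (f i) := by
    intro x
    choose f hf using fun i => ReesQuotient.mk_surjective I _ (x i)
    exact ⟨f, funext fun i => (hf i).symm⟩
  have hinj : Function.Injective L := by
    rw [injective_iff_map_eq_zero]
    intro x hx
    obtain ⟨f, rfl⟩ := hrep x
    rw [hL, tangentCone_mk_eq_zero_iff hA hpow] at hx
    refine funext fun i => (fiberCone_mk_eq_zero_iff hA.mem hIm _).mpr fun n => ?_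
    rw [← coeff_sum_mul_aperyRees hA hpow hIm hI]
    exact hx i n
  have hsurj : Function.Surjective L := by
    intro y
    obtain ⟨g, rfl⟩ := ReesQuotient.mk_surjective _ _ y
    choose f hf using fun l => exists_reesAlgebra_coeff_eq hA.mem hIm
      (fun n => coeff (w l + n * m) ((g : Polynomial (semigroupRing k Γ)).coeff (o l + n)))
      ((g : Polynomial (semigroupRing k Γ)).natDegree + 1) (fun n hn => by
        rw [Polynomial.coeff_eq_zero_of_natDegree_lt (by omega), map_zero])
    refine ⟨fun i => ReesQuotient.mk I _ (f i), ?_⟩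
    rw [hL, ← sub_eq_zero, ← map_sub, tangentCone_mk_eq_zero_iff hA hpow]
    intro l n
    rw [AddSubgroupClass.coe_sub, Polynomial.coeff_sub, map_sub,
      coeff_sum_mul_aperyRees hA hpow hIm hI, hf, sub_self]
  refine ⟨LinearEquiv.ofBijective L ⟨hinj, hsurj⟩, fun d x => ?_⟩
  obtain ⟨f, rfl⟩ := hrep x
  change L _ ∈ _ ↔ _
  rw [hL, tangentCone_mk_mem_component_iff hA hpow]
  refine forall_congr' fun l => ?_
  rw [twist, fiberCone_mk_mem_component_iff hA.mem hIm]
  refine forall_congr' fun n => ?_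
  rw [coeff_sum_mul_aperyRees hA hpow hIm hI]
  refine imp_congr_left (not_congr ?_)
  push_cast
  omega

end TangentCone

/-! ### Arithmetic of the Bresinsky semigroup and its Apéry set -/

section Bresinsky

/-- Modulo `b + 1` only `E * b` survives, modulo `b` only `2 * D * (b + 1)`; oddness of `b` allows
cancelling the `2`. -/
theorem eq_and_eq_of_mul_add_eq {b d d' E E' D D' : ℕ} (hb : Odd b)
    (hE : E < b + 1) (hE' : E' < b + 1) (hD : D < b) (hD' : D' < b)
    (h : d * ((b + 1) * b) + E * b + 2 * D * (b + 1) =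
      d' * ((b + 1) * b) + E' * b + 2 * D' * (b + 1)) : d = d' ∧ E = E' ∧ D = D' := by
  have hc : Nat.Coprime (b + 1) b := by simp
  have h1 : E ≡ E' [MOD b + 1] := by
    have e : ∀ d E D : ℕ, d * ((b + 1) * b) + E * b + 2 * D * (b + 1) ≡ E * b [MOD b + 1] := by
      intro d E D
      rw [show d * ((b + 1) * b) + E * b + 2 * D * (b + 1) =
        E * b + (b + 1) * (d * b + 2 * D) by ring]
      exact Nat.add_mul_mod_self_left _ _ _
    have := (e d E D).symm.trans (h ▸ e d' E' D')
    exact this.cancel_right_of_coprime hc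
  have h2 : D ≡ D' [MOD b] := by
    have e : ∀ d E D : ℕ, d * ((b + 1) * b) + E * b + 2 * D * (b + 1) ≡
        2 * D * (b + 1) [MOD b] := by
      intro d E D
      rw [show d * ((b + 1) * b) + E * b + 2 * D * (b + 1) =
        2 * D * (b + 1) + b * (d * (b + 1) + E) by ring]
      exact Nat.add_mul_mod_self_left _ _ _
    have := (e d E D).symm.trans (h ▸ e d' E' D')
    exact (this.cancel_right_of_coprime hc.symm).cancel_left_of_coprime hb.coprime_two_right
  obtain rfl := h1.eq_of_lt_of_lt hE hE'
  obtain rfl := h2.eq_of_lt_of_lt hD hD'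
  refine ⟨?_, rfl, rfl⟩
  have hpos : 0 < (b + 1) * b := Nat.mul_pos b.succ_pos hb.pos
  exact Nat.eq_of_mul_eq_mul_right hpos (by omega)

theorem le_of_mul_add_eq {b d d' E E' D D' : ℕ} (hb : Odd b) (hE' : E' < b + 1) (hD' : D' < b)
    (h : d * ((b + 1) * b) + E * b + 2 * D * (b + 1) =
      d' * ((b + 1) * b) + E' * b + 2 * D' * (b + 1)) :
    d ≤ d' := by
  have hE := Nat.mod_add_div' E (b + 1)
  have hD := Nat.mod_add_div' D b
  -- The added terms are the carries: `(b + 1) * b` is one copy of `m₀`, and `2 * b * (b + 1)` is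
  -- two.
  have h1 := (eq_and_eq_of_mul_add_eq (d := d + E / (b + 1) + 2 * (D / b)) hb
    (Nat.mod_lt E b.succ_pos) hE' (Nat.mod_lt D hb.pos) hD' (by
      rw [← h]
      nth_rewrite 3 [← hE]
      nth_rewrite 3 [← hD]
      ring)).1
  exact h1 ▸ (Nat.le_add_right _ _).trans (Nat.le_add_right _ _)

variable {h : ℕ}

/-- The index set of the Apéry set of `Γ_h`: `2j + 1` elements of order `j` for each
`j ≤ 2h - 2`, and `2h - 1` elements of order `2h - 1`. -/
abbrev BresinskyIndex (h : ℕ) : Type :=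
  (Σ j : Fin (2 * h - 1), Fin (2 * (j : ℕ) + 1)) ⊕ Fin (2 * h - 1)

namespace BresinskyIndex

/-- The order of an Apéry element. -/
def order : BresinskyIndex h → ℕ
  | .inl x => x.1
  | .inr _ => 2 * h - 1

/-- The number of summands `m₁`, `m₃` in a factorization of an Apéry element. -/
def fst : BresinskyIndex h → ℕ
  | .inl x => if (x.2 : ℕ) ≤ x.1 then x.1 else x.2 - x.1 - 1
  | .inr _ => 2 * h - 1

/-- The number of summands `m₂`, `m₃` in a factorization of an Apéry element. -/
def snd : BresinskyIndex h → ℕ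
  | .inl x => if (x.2 : ℕ) ≤ x.1 then x.2 else x.1
  | .inr l => l

/-- Pairs with maximum `j ≤ 2h - 2` form a hook: `j + 1` with first entry `j`, then `j` with second
entry `j` and smaller first entry. Maximum `2h - 1` is reached only by the first entry. -/
theorem order_eq (i : BresinskyIndex h) : i.order = max i.fst i.snd := by
  rcases i with ⟨j, l⟩ | l
  · simp only [order, fst, snd]
    have := l.2
    split_ifs <;> omega
  · simp only [order, fst, snd]
    omega

theorem fst_lt (i : BresinskyIndex h) : i.fst < 2 * h - 1 + 1 := by
  rcases i with ⟨j, l⟩ | l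
  · simp only [fst]
    have := l.2
    have := j.2
    split_ifs <;> omega
  · simp only [fst]
    omega

theorem snd_lt (i : BresinskyIndex h) : i.snd < 2 * h - 1 := by
  rcases i with ⟨j, l⟩ | l
  · simp only [snd]
    have := j.2
    split_ifs <;> omega
  · exact l.2

theorem ext_fst_snd {i i' : BresinskyIndex h} (h1 : i.fst = i'.fst) (h2 : i.snd = i'.snd) :
    i = i' := by
  have h0 : i.order = i'.order := by rw [order_eq, order_eq, h1, h2]
  rcases i with ⟨j, l⟩ | l <;> rcases i' with ⟨j', l'⟩ | l'
  · obtain rfl : j = j' := Fin.ext h0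
    simp only [fst, snd] at h1 h2
    obtain rfl : l = l' := by
      refine Fin.ext ?_
      split_ifs at h1 h2 <;> omega
    rfl
  · have := j.2
    simp only [order] at h0
    omega
  · have := j'.2
    simp only [order] at h0
    omega
  · exact congrArg _ (Fin.ext h2)

theorem exists_fst_snd {E D : ℕ} (hE : E < 2 * h - 1 + 1) (hD : D < 2 * h - 1) :
    ∃ i : BresinskyIndex h, i.fst = E ∧ i.snd = D := by
  by_cases h1 : E = 2 * h - 1
  · exact ⟨.inr ⟨D, hD⟩, h1.symm, rfl⟩
  by_cases h2 : D ≤ E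
  · exact ⟨.inl ⟨⟨E, by omega⟩, ⟨D, by simp only; omega⟩⟩, by simp [fst, h2], by simp [snd, h2]⟩
  · refine ⟨.inl ⟨⟨D, hD⟩, ⟨D + 1 + E, by simp only; omega⟩⟩, ?_, ?_⟩
    · simp only [fst]
      split_ifs <;> omega
    · simp only [snd]
      split_ifs <;> omega

/-- The Apéry element with a given index. -/
def value (i : BresinskyIndex h) : ℕ :=
  i.order * ((2 * h - 1 + 1) * (2 * h - 1)) + i.fst * (2 * h - 1) + 2 * i.snd * (2 * h - 1 + 1)

end BresinskyIndex

theorem exists_of_mem_bresinsky (hh : 1 ≤ h) {s : ℕ} (hs : s ∈ bresinsky h) :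
    ∃ d E D, E ≤ d ∧ D ≤ d ∧
      s = d * ((2 * h - 1 + 1) * (2 * h - 1)) + E * (2 * h - 1) + 2 * D * (2 * h - 1 + 1) := by
  obtain ⟨b, hb⟩ : ∃ b, 2 * h = b + 1 := ⟨2 * h - 1, by omega⟩
  rw [bresinsky, hb] at hs
  rw [hb]
  simp only [Nat.add_sub_cancel] at *
  induction hs using AddSubmonoid.closure_induction with
  | mem x hx =>
    simp only [Set.mem_insert_iff, Set.mem_singleton_iff] at hx
    rcases hx with rfl | rfl | rfl | rfl
    · exact ⟨1, 0, 0, by omega, by omega, by ring⟩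
    · exact ⟨1, 1, 0, by omega, by omega, by ring⟩
    · exact ⟨1, 0, 1, by omega, by omega, by ring⟩
    · exact ⟨1, 1, 1, by omega, by omega, by ring⟩
  | zero => exact ⟨0, 0, 0, le_rfl, le_rfl, by simp⟩
  | add x y _ _ hx hy =>
    obtain ⟨d, E, D, h1, h2, rfl⟩ := hx
    obtain ⟨d', E', D', h1', h2', rfl⟩ := hy
    exact ⟨d + d', E + E', D + D', by omega, by omega, by ring⟩

theorem tPow_congr {k : Type*} [Field k] {Γ : AddSubmonoid ℕ} {s t : ℕ} (hs : s ∈ Γ)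
    (hst : s = t) : tPow k s hs = tPow k t (hst ▸ hs) := by
  subst hst
  rfl

/-- A product of `d` of the monomials `t^{mᵢ}`, of which `E` have `i` odd and `D` have `i ≥ 2`. -/
theorem exists_tPow_mem_maximalIdeal_pow (k : Type*) [Field k] (hh : 2 ≤ h) {d E D : ℕ}
    (hE : E ≤ d) (hD : D ≤ d) :
    ∃ hs : d * ((2 * h - 1 + 1) * (2 * h - 1)) + E * (2 * h - 1) + 2 * D * (2 * h - 1 + 1) ∈
      bresinsky h, tPow k _ hs ∈ maximalIdeal (BresinskyRing k h) ^ d := by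
  obtain ⟨b, hb⟩ : ∃ b, 2 * h = b + 1 := ⟨2 * h - 1, by omega⟩
  have hgen : ∀ e ≤ 1, ∀ f ≤ 1, (b + 1) * b + e * b + 2 * f * (b + 1) ∈ bresinsky h := by
    intro e he f hf
    refine AddSubmonoid.subset_closure ?_
    rw [hb, Nat.add_sub_cancel]
    simp only [Set.mem_insert_iff, Set.mem_singleton_iff]
    interval_cases e <;> interval_cases f
    · left; ring
    · right; right; left; ring
    · right; left; ring
    · right; right; right; ring
  rw [hb, Nat.add_sub_cancel]
  induction d generalizing E D with
  | zero =>
    obtain rfl : E = 0 := by omega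
    obtain rfl : D = 0 := by omega
    exact ⟨by simp, by simp⟩
  | succ d ih =>
    -- One generator is split off, using `e = 1` only when `E = d + 1`. The choice of `f` is
    -- independent, since all four pairs `(e, f)` occur among the generators.
    obtain ⟨e, he, E', hE', rfl⟩ : ∃ e ≤ 1, ∃ E' ≤ d, E = E' + e := by
      rcases Nat.lt_or_ge d E with h1 | h1
      · exact ⟨1, le_rfl, d, le_rfl, by omega⟩
      · exact ⟨0, by omega, E, h1, rfl⟩
    obtain ⟨f, hf, D', hD', rfl⟩ : ∃ e ≤ 1, ∃ D' ≤ d, D = D' + e := by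
      rcases Nat.lt_or_ge d D with h1 | h1
      · exact ⟨1, le_rfl, d, le_rfl, by omega⟩
      · exact ⟨0, by omega, D, h1, rfl⟩
    obtain ⟨hs, hmem⟩ := ih hE' hD'
    have hne : (b + 1) * b + e * b + 2 * f * (b + 1) ≠ 0 := by
      have : (b + 1) * b ≠ 0 := Nat.mul_ne_zero (by omega) (by omega)
      omega
    have h1 := Ideal.mul_mem_mul hmem (tPow_mem_maximalIdeal (k := k) _ (hgen e he f hf) hne)
    rw [semigroupRing.tPow_mul_tPow, tPow_congr (t := (d + 1) * ((b + 1) * b) +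
      (E' + e) * b + 2 * (D' + f) * (b + 1)) _ (by ring), ← pow_succ] at h1
    exact ⟨_, h1⟩

theorem isAperyOrder_bresinsky (hh : 2 ≤ h) :
    IsAperyOrder (bresinsky h) (2 * h * (2 * h - 1)) (ι := BresinskyIndex h)
      BresinskyIndex.value BresinskyIndex.order := by
  have hodd : Odd (2 * h - 1) := ⟨h - 1, by omega⟩
  have hm : 2 * h * (2 * h - 1) = (2 * h - 1 + 1) * (2 * h - 1) := by
    rw [Nat.sub_add_cancel (by omega)]
  refine ⟨m0_mem_bresinsky h, Nat.mul_ne_zero (by omega) (by omega), ?_, ?_, ?_, ?_, ?_⟩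
  · intro i
    have := i.order_eq
    -- Membership in the semigroup does not involve the field; `ℚ` is an arbitrary choice.
    exact (exists_tPow_mem_maximalIdeal_pow ℚ hh (by omega) (by omega)).1
  · intro s hs
    obtain ⟨d, E, D, hE, hD, rfl⟩ := exists_of_mem_bresinsky (by omega) hs
    rw [hm]
    obtain ⟨i, hi1, hi2⟩ := BresinskyIndex.exists_fst_snd
      (Nat.mod_lt E (2 * h - 1).succ_pos) (Nat.mod_lt D hodd.pos)
    have h1 := i.order_eq
    have hE' := Nat.mod_add_div' E (2 * h - 1 + 1)
    have hD' := Nat.mod_add_div' D (2 * h - 1)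
    have hle1 : i.fst ≤ E := hi1 ▸ Nat.mod_le _ _
    have hle2 : i.snd ≤ D := hi2 ▸ Nat.mod_le _ _
    obtain ⟨c, rfl⟩ : ∃ c, d = i.order + c := ⟨d - i.order, by omega⟩
    -- The number of copies of `m₀` is the surplus `c` over the order of the reduced pair, plus the
    -- carries.
    refine ⟨i, c + E / (2 * h - 1 + 1) + 2 * (D / (2 * h - 1)), ?_⟩
    rw [BresinskyIndex.value, hi1, hi2]
    nth_rewrite 1 [← hE']
    nth_rewrite 1 [← hD']
    ring
  · intro i j n n' hij
    rw [hm] at hij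
    obtain ⟨-, h1, h2⟩ := eq_and_eq_of_mul_add_eq (d := i.order + n) (d' := j.order + n') hodd
      i.fst_lt j.fst_lt i.snd_lt j.snd_lt (by
        simp only [BresinskyIndex.value] at hij
        linarith)
    exact BresinskyIndex.ext_fst_snd h1 h2
  · intro i j l n n' hij
    rw [hm] at hij
    have := le_of_mul_add_eq (d := i.order + j.order + n)
      (E := i.fst + j.fst) (D := i.snd + j.snd) (d' := l.order + n') hodd
      l.fst_lt l.snd_lt (by
        simp only [BresinskyIndex.value] at hij
        linarith)
    exact this
  · intro i hi
    have h1 := i.order_eq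
    rw [BresinskyIndex.value, hi, show i.fst = 0 by omega, show i.snd = 0 by omega]
    simp

end Bresinsky

end MonomialCurve

end

/-! ### The graded decomposition for the Bresinsky curve -/

theorem mainTheorem1 (k : Type*) [Field k] (h : ℕ) (hh : 2 ≤ h) :
    letI : Module (MonomialCurve.FiberCone (MonomialCurve.bresinskyIdeal k h))
        (MonomialCurve.TangentCone (MonomialCurve.BresinskyRing k h)) :=
      MonomialCurve.tangentConeModule (MonomialCurve.bresinskyIdeal_le k hh)
    Module.Free (MonomialCurve.FiberCone (MonomialCurve.bresinskyIdeal k h))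
        (MonomialCurve.TangentCone (MonomialCurve.BresinskyRing k h)) ∧
    -- an isomorphism of modules over the fiber cone that matches the homogeneous components
    ∃ φ : (((j : Fin (2 * h - 1)) → Fin (2 * (j : ℕ) + 1) →
              MonomialCurve.FiberCone (MonomialCurve.bresinskyIdeal k h)) ×
            (Fin (2 * h - 1) → MonomialCurve.FiberCone (MonomialCurve.bresinskyIdeal k h)))
          ≃ₗ[MonomialCurve.FiberCone (MonomialCurve.bresinskyIdeal k h)]
          MonomialCurve.TangentCone (MonomialCurve.BresinskyRing k h),
      ∀ (n : ℤ) x,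
        φ x ∈ MonomialCurve.tangentConeComponent (MonomialCurve.BresinskyRing k h) n ↔
          (∀ (j : Fin (2 * h - 1)) (l : Fin (2 * (j : ℕ) + 1)),
            x.1 j l ∈ MonomialCurve.twist
              (MonomialCurve.fiberConeComponent (MonomialCurve.bresinskyIdeal k h))
              (-((j : ℕ) : ℤ)) n) ∧
          (∀ l : Fin (2 * h - 1),
            x.2 l ∈ MonomialCurve.twist
              (MonomialCurve.fiberConeComponent (MonomialCurve.bresinskyIdeal k h))
              (-(2 * (h : ℤ) - 1)) n) := by
  let : Module (MonomialCurve.FiberCone (MonomialCurve.bresinskyIdeal k h))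
      (MonomialCurve.TangentCone (MonomialCurve.BresinskyRing k h)) :=
    MonomialCurve.tangentConeModule (MonomialCurve.bresinskyIdeal_le k hh)
  obtain ⟨φ, hφ⟩ := MonomialCurve.exists_graded_linearEquiv_tangentCone (k := k)
    (MonomialCurve.isAperyOrder_bresinsky hh)
    (fun i => (MonomialCurve.exists_tPow_mem_maximalIdeal_pow k hh
      (i.order_eq ▸ le_max_left _ _) (i.order_eq ▸ le_max_right _ _)).2)
    (I := MonomialCurve.bresinskyIdeal k h) rfl (MonomialCurve.bresinskyIdeal_le k hh)
  -- Reindexing only: functions on the Apéry index type are split along the sum and curried along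
  -- the sigma type.
  let e := (LinearEquiv.sumArrowLequivProdArrow
      (Σ j : Fin (2 * h - 1), Fin (2 * (j : ℕ) + 1)) (Fin (2 * h - 1))
      (MonomialCurve.FiberCone (MonomialCurve.bresinskyIdeal k h))
      (MonomialCurve.FiberCone (MonomialCurve.bresinskyIdeal k h))).trans
    ((LinearEquiv.piCurry (MonomialCurve.FiberCone (MonomialCurve.bresinskyIdeal k h))
      fun _ _ => MonomialCurve.FiberCone (MonomialCurve.bresinskyIdeal k h)).prodCongr
      (LinearEquiv.refl _ _))
  refine ⟨Module.Free.of_equiv φ, e.symm.trans φ, fun n x => ?_⟩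
  obtain ⟨y, rfl⟩ := e.surjective x
  rw [LinearEquiv.trans_apply, LinearEquiv.symm_apply_apply, hφ, Sum.forall, Sigma.forall]
  refine and_congr Iff.rfl (forall_congr' fun l => ?_)
  have hcast : (MonomialCurve.BresinskyIndex.order (h := h) (Sum.inr l) : ℤ) = 2 * (h : ℤ) - 1 := by
    change ((2 * h - 1 : ℕ) : ℤ) = _
    omega
  rw [hcast]
  rfl
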